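/- For a finite simple graph $G=(V,E)$ let $\mathrm{vr}(G)$ be the least $k$ for which there is a colouring $c:V\to\{1,\dots,k\}$ such that every simple path between two distinct vertices $u,v$ with $c(u)=c(v)$ contains a vertex $w$ with $c(w)>c(u)$. Let $\mathrm{pw}(G)$ and $\mathrm{tw}(G)$ be the path-width and the tree-width of $G$, and let $$h(G)=\min_{X\subseteq V,\ 0<|X|\le |V|/2}\ \frac{|\{v\in V\setminus X:\ v\text{ has a neighbour in }X\}|}{|X|}$$ be its vertex expansion. There exist an infinite family $\mathcal F$ of (pairwise distinct, finite) $3$-regular graphs, with vertex sets of the form $\{0,\dots,n-1\}$, and constants $h>0$ and $c>0$ such that every $G\in\mathcal F$ satisfies $h(G)\ge h$ and $$\mathrm{vr}(G)\ \ge\ \mathrm{pw}(G)\ \ge\ \mathrm{tw}(G)\ \ge\ \frac{h(G)\cdot|V(G)|}{4},\qquad \mathrm{vr}(G)\ \ge\ c\,|V(G)| .$$ In particular $\mathrm{vr}(G)=\Omega(|V(G)|)$ on $\mathcal F$; since there are only finitely many graphs on each vertex set $\{0,\dots,n-1\}$, the graphs in $\mathcal F$ have unboundedly many vertices. -/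

import Mathlib

namespace VRank

/-- A vertex-ranking with `k` colours: every simple path between two distinct vertices of the same
colour contains a vertex of strictly larger colour. -/
def IsVertexRanking {V : Type*} (G : SimpleGraph V) {k : ℕ} (c : V → Fin k) : Prop :=
  ∀ u v : V, u ≠ v → c u = c v → ∀ p : G.Walk u v, p.IsPath → ∃ w ∈ p.support, c u < c w

/-- The vr-number of a finite graph: the least number of colours of a vertex-ranking. -/
noncomputable def vr {V : Type*} [Fintype V] (G : SimpleGraph V) : ℕ :=
  sInf {k : ℕ | ∃ c : V → Fin k, IsVertexRanking G c}

/-- `B` is a tree decomposition of `G` over the tree `T`. -/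
structure IsTreeDecomposition {V ι : Type*} (G : SimpleGraph V) (T : SimpleGraph ι)
    (B : ι → Finset V) : Prop where
  isTree : T.IsTree
  exists_mem_bag : ∀ v : V, ∃ i, v ∈ B i
  exists_adj_bag : ∀ u v : V, G.Adj u v → ∃ i, u ∈ B i ∧ v ∈ B i
  preconnected : ∀ v : V, (T.induce {i | v ∈ B i}).Preconnected

/-- The tree-width of a finite graph: the least `w` such that some tree decomposition over a finite
tree has all bags of size at most `w + 1`. -/
noncomputable def treewidth {V : Type*} [Fintype V] (G : SimpleGraph V) : ℕ :=
  sInf {w : ℕ | ∃ (m : ℕ) (T : SimpleGraph (Fin m)) (B : Fin m → Finset V),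
    IsTreeDecomposition G T B ∧ ∀ i, (B i).card ≤ w + 1}

/-- The sequence of bags `B 0, …, B (m - 1)` is a path decomposition of `G`. -/
structure IsPathDecomposition {V : Type*} (G : SimpleGraph V) {m : ℕ}
    (B : Fin m → Finset V) : Prop where
  exists_mem_bag : ∀ v : V, ∃ i, v ∈ B i
  exists_adj_bag : ∀ u v : V, G.Adj u v → ∃ i, u ∈ B i ∧ v ∈ B i
  interval : ∀ v : V, ∀ i j l : Fin m, i ≤ j → j ≤ l → v ∈ B i → v ∈ B l → v ∈ B j

/-- The path-width of a finite graph: the least `w` such that some path decomposition has all bags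
of size at most `w + 1`. -/
noncomputable def pathwidth {V : Type*} [Fintype V] (G : SimpleGraph V) : ℕ :=
  sInf {w : ℕ | ∃ (m : ℕ) (B : Fin m → Finset V),
    IsPathDecomposition G B ∧ ∀ i, (B i).card ≤ w + 1}

/-- The set of vertices outside `X` that have a neighbour in `X`. -/
def outerBoundary {V : Type*} (G : SimpleGraph V) (X : Finset V) : Set V :=
  {v | v ∉ X ∧ ∃ u ∈ X, G.Adj u v}

/-- The vertex expansion of a finite graph: the minimum of `|∂X| / |X|` over all vertex sets `X`
with `0 < |X| ≤ |V| / 2`. -/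
noncomputable def vertexExpansion {V : Type*} [Fintype V] (G : SimpleGraph V) : ℝ :=
  sInf {r : ℝ | ∃ X : Finset V, X.Nonempty ∧ 2 * X.card ≤ Fintype.card V ∧
    r = ((outerBoundary G X).ncard : ℝ) / (X.card : ℝ)}

open Classical in
/-- A finite graph in which every vertex has degree `3`. -/
def IsCubic {V : Type*} [Fintype V] (G : SimpleGraph V) : Prop :=
  G.IsRegularOfDegree 3

end VRank

/-! The inequalities between the parameters are deterministic; the linear lower bound needs
expanders, obtained by a counting argument. Ranking to path-width (`pathwidth_le_vr`): a ranking
arranges the vertices in a rooted forest. The sets of ancestors, taken in depth-first order, form a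
path decomposition whose bags have at most `vr` vertices. Expansion to tree-width
(`vertexExpansion_mul_card_le`): some bag S is a balanced separator. Grouping the pieces it leaves
gives X with |X| ≤ n/2, n ≤ 3|X| + |S| and outer boundary inside S, so h·n ≤ (3 + h)(tw + 1). In a
large cubic graph h ≤ 4/5, hence 3 + h < 4, and the slack absorbs the +1 once h·n ≥ 76. Expanders:
by a union bound, some 24 permutations of W expand every set of at most half the points by 3/2
(`exists_isExpandingFamily`). Replacing each point by a 48-cycle of ports, one for each permutation
and each inverse, makes the graph cubic and keeps vertex expansion at least 1/144
(`IsExpandingFamily.card_le`). -/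

namespace VRank

/-! ### Balanced separators from tree decompositions -/

section TreeSeparator

variable {V ι : Type*} {G : SimpleGraph V} {T : SimpleGraph ι} {B : ι → Finset V}

/-- The unique path between two vertices of a tree. -/
noncomputable def treePath (hT : T.IsTree) (t i : ι) : T.Walk t i :=
  (hT.existsUnique_path t i).choose

lemma treePath_isPath (hT : T.IsTree) (t i : ι) : (treePath hT t i).IsPath :=
  (hT.existsUnique_path t i).choose_spec.1

lemma eq_treePath (hT : T.IsTree) {t i : ι} {p : T.Walk t i} (hp : p.IsPath) :
    p = treePath hT t i :=
  (hT.existsUnique_path t i).unique hp (treePath_isPath hT t i)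

/-- The first step on the way from `t` to `i` in a tree. -/
noncomputable def firstStep (hT : T.IsTree) (t i : ι) : ι := (treePath hT t i).snd

lemma adj_firstStep (hT : T.IsTree) {t i : ι} (h : t ≠ i) : T.Adj t (firstStep hT t i) :=
  SimpleGraph.Walk.adj_snd (SimpleGraph.Walk.not_nil_of_ne h)

lemma length_treePath (hT : T.IsTree) {t i : ι} (h : t ≠ i) :
    (treePath hT t i).length = (treePath hT (firstStep hT t i) i).length + 1 := by
  have h1 := SimpleGraph.Walk.length_tail_add_one
    (SimpleGraph.Walk.not_nil_of_ne h : ¬ (treePath hT t i).Nil)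
  rw [← h1, eq_treePath hT (treePath_isPath hT t i).tail]
  rfl

lemma snd_concat {i j k : ι} {p : T.Walk i j} (hp : ¬ p.Nil) (h : T.Adj j k) : (p.concat h).snd = p.snd := by
  cases p with
  | nil => simp at hp
  | cons h' q => simp [SimpleGraph.Walk.concat_cons]

/-- In a tree, of the paths from t to two adjacent vertices, one extends the other by a single edge.
-/
lemma firstStep_eq_of_adj (hT : T.IsTree) {t i j : ι} (hi : t ≠ i) (hj : t ≠ j)
    (hij : T.Adj i j) : firstStep hT t i = firstStep hT t j := by
  by_cases h : i ∈ (treePath hT t j).support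
  · have := hT.isAcyclic.path_concat (treePath_isPath hT t i) (treePath_isPath hT t j) hij h
    rw [firstStep, firstStep, this, snd_concat (SimpleGraph.Walk.not_nil_of_ne hi)]
  · have h' := hT.isAcyclic.mem_support_of_ne_mem_support_of_adj_of_isPath
      (treePath_isPath hT t i) (treePath_isPath hT t j) hij h
    have := hT.isAcyclic.path_concat (treePath_isPath hT t j) (treePath_isPath hT t i) hij.symm h'
    rw [firstStep, firstStep, this, snd_concat (SimpleGraph.Walk.not_nil_of_ne hj)]

/-- The bags containing v form a subtree avoiding t, so they all lie on the same side of t. -/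
lemma IsTreeDecomposition.firstStep_eq (hD : IsTreeDecomposition G T B) {t i j : ι} {v : V}
    (hv : v ∉ B t) (hi : v ∈ B i) (hj : v ∈ B j) :
    firstStep hD.isTree t i = firstStep hD.isTree t j := by
  obtain ⟨w⟩ := hD.preconnected v ⟨i, hi⟩ ⟨j, hj⟩
  have key : ∀ (x y : {i | v ∈ B i}), (T.induce {i | v ∈ B i}).Walk x y →
      firstStep hD.isTree t x = firstStep hD.isTree t y := by
    intro x y w
    induction w with
    | nil => rfl
    | @cons a b c h _ ih =>
      rw [← ih]
      refine firstStep_eq_of_adj hD.isTree ?_ ?_ h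
      · rintro rfl; exact hv a.2
      · rintro rfl; exact hv b.2
  exact key _ _ w

/-- A function on a finite tree that moves every vertex to a neighbour exchanges the ends of some
edge. -/
lemma exists_involutive_of_isTree [Finite ι] (hT : T.IsTree) (f : ι → ι) (hf : ∀ t, T.Adj t (f t)) :
    ∃ t, f (f t) = t := by
  classical
  have := Fintype.ofFinite ι
  have hcard := hT.card_edgeFinset
  -- Pigeonhole: a tree has one more vertex than edges.
  obtain ⟨x, -, y, -, hxy, he⟩ := Finset.exists_ne_map_eq_of_card_lt_of_maps_to
    (s := Finset.univ) (t := T.edgeFinset) (f := fun t => s(t, f t))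
    (by rw [Finset.card_univ]; omega) (fun t _ => by simpa using hf t)
  rcases Sym2.eq_iff.1 he with h | h
  · exact absurd h.1 hxy
  · exact ⟨x, by rw [h.2, ← h.1]⟩

/-- Some bag of a tree decomposition is a balanced separator. -/
theorem IsTreeDecomposition.exists_balanced [Fintype V] [DecidableEq V] [Finite ι] [DecidableEq ι]
    (hD : IsTreeDecomposition G T B) :
    ∃ t, ∃ f : V → ι, (∀ u v, u ∉ B t → v ∉ B t → G.Adj u v → f u = f v) ∧
      ∀ j, 2 * (Finset.univ.filter fun v => v ∉ B t ∧ f v = j).card ≤ Fintype.card V := by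
  choose b hb using hD.exists_mem_bag
  by_contra! hcon
  have hbig := fun t => hcon t (fun v => firstStep hD.isTree t (b v)) (by
    intro u v hu hv huv
    obtain ⟨i, hui, hvi⟩ := hD.exists_adj_bag u v huv
    exact (hD.firstStep_eq hu (hb u) hui).trans (hD.firstStep_eq hv hvi (hb v)))
  -- If no bag is balanced, every t has a direction `f t` holding more than half of the vertices.
  choose f hf using hbig
  have hadj : ∀ t, T.Adj t (f t) := by
    intro t
    have hpos : 0 < (Finset.univ.filter fun v => v ∉ B t ∧
        firstStep hD.isTree t (b v) = f t).card := by
      have := hf t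
      omega
    obtain ⟨v, hv⟩ := Finset.card_pos.1 hpos
    obtain ⟨hv, he⟩ := (Finset.mem_filter.1 hv).2
    rw [← he]
    refine adj_firstStep hD.isTree ?_
    intro h
    exact hv (h ▸ hb v)
  obtain ⟨t, ht⟩ := exists_involutive_of_isTree hD.isTree f hadj
  have h1 := hf t
  have h2 := hf (f t)
  have : ∃ v, v ∈ (Finset.univ.filter fun v => v ∉ B t ∧ firstStep hD.isTree t (b v) = f t) ∧
      v ∈ (Finset.univ.filter fun v => v ∉ B (f t) ∧
        firstStep hD.isTree (f t) (b v) = f (f t)) := by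
    by_contra! hno
    have hdis := Finset.disjoint_left.2 hno
    have := Finset.card_le_univ (Finset.disjUnion _ _ hdis)
    rw [Finset.card_disjUnion] at this
    omega
  obtain ⟨v, hv1, hv2⟩ := this
  simp only [Finset.mem_filter, Finset.mem_univ, true_and] at hv1 hv2
  -- The two majorities across the edge share v, so each end would be strictly closer to `b v` than
  -- the other.
  have e1 := length_treePath hD.isTree (t := t) (i := b v) (fun h => hv1.1 (h ▸ hb v))
  have e2 := length_treePath hD.isTree (t := f t) (i := b v) (fun h => hv2.1 (h ▸ hb v))
  rw [hv1.2] at e1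
  rw [hv2.2, ht] at e2
  omega

end TreeSeparator

/-! ### Grouping the pieces left by a separator -/

section Closed

variable {V : Type*} [DecidableEq V] {G : SimpleGraph V}

/-- Take K minimal with union at least a third of U. If neither that union nor its complement in U
works, the union exceeds two thirds; dropping any piece leaves less than a third, so that piece
alone exceeds a third. -/
lemma exists_union_card {ι : Type*} [DecidableEq ι] (A : ι → Finset V) (J : Finset ι) (U : Finset V)
    (hU : J.biUnion A = U) (n : ℕ) (hUn : U.card ≤ n) (hA : ∀ i, 2 * (A i).card ≤ n) :
    ∃ K ⊆ J, (U.card ≤ 3 * (K.biUnion A).card ∧ 2 * (K.biUnion A).card ≤ n) ∨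
      (U.card ≤ 3 * (U \ K.biUnion A).card ∧ 2 * (U \ K.biUnion A).card ≤ n) := by
  obtain ⟨K, hK, hmin⟩ := (J.powerset.filter fun K => U.card ≤ 3 * (K.biUnion A).card).exists_minimal
    ⟨J, by simp [hU]; omega⟩
  simp only [Finset.mem_filter, Finset.mem_powerset] at hK hmin
  have hsub : K.biUnion A ⊆ U := hU ▸ Finset.biUnion_subset_biUnion_of_subset_left A hK.1
  have hsd := Finset.card_sdiff_add_card_eq_card hsub
  by_cases h1 : 2 * (K.biUnion A).card ≤ n
  · exact ⟨K, hK.1, .inl ⟨hK.2, h1⟩⟩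
  by_cases h2 : U.card ≤ 3 * (U \ K.biUnion A).card
  · exact ⟨K, hK.1, .inr ⟨h2, by omega⟩⟩
  obtain ⟨i, hi⟩ : K.Nonempty := by
    rw [Finset.nonempty_iff_ne_empty]
    rintro rfl
    simp at h1
  have h3 : ¬ U.card ≤ 3 * ((K.erase i).biUnion A).card := by
    intro h
    have := hmin ⟨(Finset.erase_subset _ _).trans hK.1, h⟩ (Finset.erase_subset _ _) hi
    simp at this
  have h4 : (K.biUnion A).card ≤ (A i).card + ((K.erase i).biUnion A).card := by
    conv_lhs => rw [← Finset.insert_erase hi, Finset.biUnion_insert]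
    exact Finset.card_union_le _ _
  refine ⟨{i}, by simpa using hK.1 hi, .inl ?_⟩
  rw [Finset.singleton_biUnion]
  exact ⟨by omega, hA i⟩

/-- A balanced separator leaves a set of moderate size whose outer boundary lies in the
separator. -/
theorem exists_outerBoundary_subset [Fintype V] {ι : Type*} [Fintype ι] [DecidableEq ι] (S : Finset V)
    (f : V → ι) (hf : ∀ u v, u ∉ S → v ∉ S → G.Adj u v → f u = f v)
    (hS : ∀ j, 2 * (Finset.univ.filter fun v => v ∉ S ∧ f v = j).card ≤ Fintype.card V) :
    ∃ X : Finset V, Fintype.card V ≤ 3 * X.card + S.card ∧ 2 * X.card ≤ Fintype.card V ∧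
      outerBoundary G X ⊆ S := by
  set A : ι → Finset V := fun j => Finset.univ.filter fun v => v ∉ S ∧ f v = j with hAdef
  have hU : Finset.univ.biUnion A = Sᶜ := by
    ext v
    simp [hAdef]
  have hc := Finset.card_compl_add_card S
  obtain ⟨K, -, h⟩ := exists_union_card A Finset.univ Sᶜ hU (Fintype.card V)
    (Finset.card_le_univ _) hS
  rcases h with h | h
  · refine ⟨K.biUnion A, by omega, h.2, ?_⟩
    rintro v ⟨hv, u, hu, huv⟩
    by_contra hvS
    simp only [Finset.mem_coe] at hvS
    simp only [hAdef, Finset.mem_biUnion, Finset.mem_filter, Finset.mem_univ, true_and] at hu hv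
    obtain ⟨j, hj, huS, rfl⟩ := hu
    exact hv ⟨_, hj, hvS, (hf u v huS hvS huv).symm⟩
  · refine ⟨Sᶜ \ K.biUnion A, by omega, h.2, ?_⟩
    rintro v ⟨hv, u, hu, huv⟩
    by_contra hvS
    simp only [Finset.mem_coe] at hvS
    simp only [hAdef, Finset.mem_sdiff, Finset.mem_compl, Finset.mem_biUnion, Finset.mem_filter,
      Finset.mem_univ, true_and] at hu hv
    refine hv ⟨hvS, ?_⟩
    rintro ⟨j, hj, -, rfl⟩
    exact hu.2 ⟨_, hj, hu.1, hf u v hu.1 hvS huv⟩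

end Closed

/-! ### Path decompositions as tree decompositions -/

lemma pathGraph_isTree (n : ℕ) : (SimpleGraph.pathGraph (n + 1)).IsTree := by
  have hconn := SimpleGraph.pathGraph_connected n
  refine SimpleGraph.isTree_iff_connected_and_card.2 ⟨hconn, le_antisymm ?_
    (by simpa using hconn.card_vert_le_card_edgeSet_add_one)⟩
  have hsub : (SimpleGraph.pathGraph (n + 1)).edgeSet ⊆
      Set.range fun i : Fin n => s(i.castSucc, i.succ) := by
    intro e
    induction e with
    | _ u v =>
      intro h
      rw [SimpleGraph.mem_edgeSet, SimpleGraph.pathGraph_adj] at h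
      rcases h with h | h
      · exact ⟨⟨u, by omega⟩, Sym2.eq_iff.2 (.inl ⟨Fin.ext rfl, Fin.ext h⟩)⟩
      · exact ⟨⟨v, by omega⟩, Sym2.eq_iff.2 (.inr ⟨Fin.ext rfl, Fin.ext h⟩)⟩
  have h1 := Nat.card_mono (Set.finite_range _) hsub
  have h2 := Finite.card_range_le fun i : Fin n => s(i.castSucc, i.succ)
  simp only [Nat.card_eq_fintype_card (α := Fin _), Fintype.card_fin] at h2 ⊢
  exact Nat.add_le_add_right (h1.trans h2) 1

lemma IsPathDecomposition.isTreeDecomposition {V : Type*} {G : SimpleGraph V} {m : ℕ}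
    {B : Fin (m + 1) → Finset V} (h : IsPathDecomposition G B) :
    IsTreeDecomposition G (SimpleGraph.pathGraph (m + 1)) B where
  isTree := pathGraph_isTree m
  exists_mem_bag := h.exists_mem_bag
  exists_adj_bag := h.exists_adj_bag
  preconnected v := by
    have key : ∀ (d : ℕ) (i j : {i | v ∈ B i}), i.1.val + d = j.1.val →
        ((SimpleGraph.pathGraph (m + 1)).induce {i | v ∈ B i}).Reachable i j := by
      intro d
      induction d with
      | zero =>
        intro i j hij
        rw [Subtype.ext (Fin.ext hij) (a1 := i) (a2 := j)]
      | succ d ih =>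
        intro i j hij
        have hlt : i.1.val + 1 < m + 1 := by omega
        have hmem : v ∈ B ⟨i.1.val + 1, hlt⟩ :=
          h.interval v i.1 _ j.1 (Fin.le_def.2 (Nat.le_succ _))
            (Fin.le_def.2 (show i.1.val + 1 ≤ j.1.val by omega)) i.2 j.2
        refine SimpleGraph.Reachable.trans (v := ⟨_, hmem⟩) ?_ (ih ⟨_, hmem⟩ j (show i.1.val + 1 + d = _ by omega))
        exact SimpleGraph.Adj.reachable (by simp [SimpleGraph.pathGraph_adj])
    intro i j
    rcases le_total i.1.val j.1.val with hij | hij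
    · exact key (j.1.val - i.1.val) i j (by omega)
    · exact (key (i.1.val - j.1.val) j i (by omega)).symm

/-- The set of widths of path decompositions is nonempty. -/
lemma exists_pathDecomposition {V : Type*} [Fintype V] (G : SimpleGraph V) :
    {w : ℕ | ∃ (m : ℕ) (B : Fin m → Finset V),
      IsPathDecomposition G B ∧ ∀ i, (B i).card ≤ w + 1}.Nonempty :=
  ⟨Fintype.card V, 1, fun _ => Finset.univ,
    ⟨fun _ => ⟨0, Finset.mem_univ _⟩, fun _ _ _ => ⟨0, Finset.mem_univ _, Finset.mem_univ _⟩,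
      fun _ _ _ _ _ _ _ _ => Finset.mem_univ _⟩, fun _ => by simp⟩

lemma exists_treeDecomposition_of_path {V : Type*} [Nonempty V] {G : SimpleGraph V} {w : ℕ}
    (h : ∃ (m : ℕ) (B : Fin m → Finset V),
      IsPathDecomposition G B ∧ ∀ i, (B i).card ≤ w + 1) :
    ∃ (m : ℕ) (T : SimpleGraph (Fin m)) (B : Fin m → Finset V),
      IsTreeDecomposition G T B ∧ ∀ i, (B i).card ≤ w + 1 := by
  obtain ⟨m, B, hB, hc⟩ := h
  cases m with
  | zero => exact (hB.exists_mem_bag (Classical.arbitrary V)).elim fun i => i.elim0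
  | succ m => exact ⟨m + 1, _, B, hB.isTreeDecomposition, hc⟩

theorem treewidth_le_pathwidth {V : Type*} [Fintype V] [Nonempty V] (G : SimpleGraph V) :
    treewidth G ≤ pathwidth G :=
  Nat.sInf_le (exists_treeDecomposition_of_path (Nat.sInf_mem (exists_pathDecomposition G)))

lemma treewidth_spec {V : Type*} [Fintype V] [Nonempty V] (G : SimpleGraph V) :
    ∃ (m : ℕ) (T : SimpleGraph (Fin m)) (B : Fin m → Finset V),
      IsTreeDecomposition G T B ∧ ∀ i, (B i).card ≤ treewidth G + 1 :=
  Nat.sInf_mem (s := {w : ℕ | ∃ (m : ℕ) (T : SimpleGraph (Fin m)) (B : Fin m → Finset V),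
    IsTreeDecomposition G T B ∧ ∀ i, (B i).card ≤ w + 1})
    ((exists_pathDecomposition G).mono fun _ => exists_treeDecomposition_of_path)

/-! ### The ancestor forest of a vertex-ranking -/

section Ranking

variable {V : Type*} {G : SimpleGraph V} {k : ℕ} {c : V → Fin k}

/-- `w` is joined to `v` by a walk on which `w` is the only vertex of maximal colour. -/
def IsAncestor (G : SimpleGraph V) (c : V → Fin k) (w v : V) : Prop :=
  ∃ p : G.Walk v w, ∀ x ∈ p.support, c x ≤ c w

lemma IsAncestor.refl (v : V) : IsAncestor G c v v := ⟨.nil, by simp⟩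

lemma IsAncestor.trans {u v w : V} (h : IsAncestor G c w v) (h' : IsAncestor G c v u) :
    IsAncestor G c w u := by
  obtain ⟨p, hp⟩ := h
  obtain ⟨q, hq⟩ := h'
  refine ⟨q.append p, fun x hx => ?_⟩
  rcases (SimpleGraph.Walk.mem_support_append_iff _ _).1 hx with hx | hx
  · exact (hq x hx).trans (hp v p.start_mem_support)
  · exact hp x hx

/-- Going from w to w' through v never exceeds their common colour, which the ranking forbids if
they differ. So a vertex has at most one ancestor of each colour. -/
lemma IsVertexRanking.eq_of_isAncestor (hc : IsVertexRanking G c) {v w w' : V}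
    (h : IsAncestor G c w v) (h' : IsAncestor G c w' v) (hww : c w = c w') : w = w' := by
  classical
  by_contra hne
  obtain ⟨p, hp⟩ := h
  obtain ⟨q, hq⟩ := h'
  obtain ⟨x, hx, hlt⟩ := hc w w' hne hww (p.reverse.append q).bypass
    (SimpleGraph.Walk.bypass_isPath _)
  rcases (SimpleGraph.Walk.mem_support_append_iff _ _).1
    (SimpleGraph.Walk.support_bypass_subset_support _ hx) with hx | hx
  · exact absurd (hp x (by simpa using hx)) (not_le.2 hlt)
  · exact absurd ((hq x hx).trans hww.ge) (not_le.2 hlt)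

/-- An ancestor of `v` of larger colour is an ancestor of every ancestor of `v` of smaller
colour. -/
lemma IsAncestor.of_le {v w x : V} (h : IsAncestor G c w v) (h' : IsAncestor G c x v)
    (hle : c w ≤ c x) : IsAncestor G c x w := by
  obtain ⟨p, hp⟩ := h
  obtain ⟨q, hq⟩ := h'
  refine ⟨p.reverse.append q, fun y hy => ?_⟩
  rcases (SimpleGraph.Walk.mem_support_append_iff _ _).1 hy with hy | hy
  · exact (hp y (by simpa using hy)).trans hle
  · exact hq y hy

lemma isAncestor_of_adj (c : V → Fin k) {u v : V} (h : G.Adj u v) :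
    IsAncestor G c v u ∨ IsAncestor G c u v := by
  rcases le_total (c u) (c v) with hl | hl
  · exact .inl ⟨h.toWalk, by simp [hl]⟩
  · exact .inr ⟨h.symm.toWalk, by simp [hl]⟩

open Classical in
/-- The ancestor of `v` of the given colour, if there is one. -/
noncomputable def ancestorOfColour (G : SimpleGraph V) (c : V → Fin k) (v : V) (j : Fin k) :
    Option V :=
  if h : ∃ w, IsAncestor G c w v ∧ c w = j then some h.choose else none

lemma IsVertexRanking.ancestorOfColour_eq_some (hc : IsVertexRanking G c) {v w : V} {j : Fin k} :
    ancestorOfColour G c v j = some w ↔ IsAncestor G c w v ∧ c w = j := by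
  unfold ancestorOfColour
  split_ifs with h
  · rw [Option.some_inj]
    constructor
    · rintro rfl
      exact h.choose_spec
    · intro hw
      exact hc.eq_of_isAncestor h.choose_spec.1 hw.1 (h.choose_spec.2.trans hw.2.symm)
  · simp only [false_iff]
    exact fun hw => h ⟨w, hw⟩

/-- Descendants of a common vertex have the same ancestors of larger colour. -/
lemma IsVertexRanking.ancestorOfColour_congr (hc : IsVertexRanking G c) {u v w : V} {j : Fin k}
    (hu : IsAncestor G c w u) (hv : IsAncestor G c w v) (hj : c w ≤ j) :
    ancestorOfColour G c u j = ancestorOfColour G c v j := by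
  ext x
  rw [hc.ancestorOfColour_eq_some, hc.ancestorOfColour_eq_some]
  constructor <;> rintro ⟨hx, rfl⟩
  · exact ⟨(hu.of_le hx hj).trans hv, rfl⟩
  · exact ⟨(hv.of_le hx hj).trans hu, rfl⟩

end Ranking

/-! ### Depth-first order and path-width -/

section Key

variable {n k : ℕ} {G : SimpleGraph (Fin n)} {c : Fin n → Fin k}

/-- The ancestors of `v`, listed by decreasing colour, as an element of a lexicographic order. -/
noncomputable def rankingKey (G : SimpleGraph (Fin n)) (c : Fin n → Fin k) (v : Fin n) :
    Lex (Fin k → WithBot (Fin n)) :=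
  toLex fun j => ancestorOfColour G c v j.rev

/-- Sequences with a common prefix form an interval in the lexicographic order. Descendants of w
share their keys down to the colour of w, which gives the interval property of bags. -/
lemma lex_eq_of_between {α : Type*} [LinearOrder α] {x y z : Lex (Fin k → α)} {j : Fin k}
    (hxy : x ≤ y) (hyz : y ≤ z) (h : ∀ i ≤ j, ofLex x i = ofLex z i) :
    ∀ i ≤ j, ofLex y i = ofLex x i := by
  intro i
  induction i using WellFoundedLT.induction with
  | ind i ih =>
    intro hi
    have hlt : ∀ i' < i, ofLex x i' = ofLex y i' := fun i' h' => (ih i' h' (h'.le.trans hi)).symm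
    refine le_antisymm ?_ (Pi.apply_le_of_toLex hxy hlt)
    rw [h i hi]
    exact Pi.apply_le_of_toLex hyz fun i' h' => (hlt i' h').symm.trans (h i' (h'.le.trans hi))

theorem pathwidth_le_vr (G : SimpleGraph (Fin n)) : pathwidth G ≤ vr G := by
  classical
  obtain ⟨c, hc⟩ : ∃ c : Fin n → Fin (vr G), IsVertexRanking G c :=
    Nat.sInf_mem (s := {k : ℕ | ∃ c : Fin n → Fin k, IsVertexRanking G c})
      ⟨n, id, fun u v huv h => absurd h huv⟩
  set S := Finset.univ.image (rankingKey G c) with hS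
  let e := S.orderIsoOfFin rfl
  let B : Fin S.card → Finset (Fin n) := fun i =>
    Finset.univ.filter fun w => ∃ j, ofLex (e i).1 j = some w
  have hmemS : ∀ v, rankingKey G c v ∈ S := fun v => Finset.mem_image_of_mem _ (Finset.mem_univ v)
  have hBkey : ∀ i, ∃ v, (e i).1 = rankingKey G c v := by
    intro i
    obtain ⟨v, -, hv⟩ := Finset.mem_image.1 (e i).2
    exact ⟨v, hv.symm⟩
  have hB : ∀ i v, (e i).1 = rankingKey G c v → ∀ w, w ∈ B i ↔ IsAncestor G c w v := by
    intro i v hv w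
    simp only [B, Finset.mem_filter, Finset.mem_univ, true_and, hv]
    constructor
    · rintro ⟨j, hj⟩
      exact (hc.ancestorOfColour_eq_some.1 hj).1
    · intro h
      refine ⟨(c w).rev, ?_⟩
      refine hc.ancestorOfColour_eq_some.2 ⟨h, ?_⟩
      simp
  have hB' : ∀ v w, IsAncestor G c w v → w ∈ B (e.symm ⟨_, hmemS v⟩) := fun v w h =>
    (hB _ v (by simp) w).2 h
  refine Nat.sInf_le ⟨S.card, B, ⟨fun v => ⟨_, hB' v v (.refl v)⟩, ?_, ?_⟩, ?_⟩
  · intro u v huv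
    rcases isAncestor_of_adj c huv with h | h
    · exact ⟨_, hB' u u (.refl u), hB' u v h⟩
    · exact ⟨_, hB' v u h, hB' v v (.refl v)⟩
  · intro w i j l hij hjl hi hl
    obtain ⟨a, ha⟩ := hBkey i
    obtain ⟨b, hb⟩ := hBkey j
    obtain ⟨d, hd⟩ := hBkey l
    rw [hB i a ha] at hi
    rw [hB l d hd] at hl
    rw [hB j b hb]
    have h1 : rankingKey G c a ≤ rankingKey G c b := by
      rw [← ha, ← hb]
      exact e.monotone hij
    have h2 : rankingKey G c b ≤ rankingKey G c d := by
      rw [← hb, ← hd]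
      exact e.monotone hjl
    have h3 := lex_eq_of_between (j := (c w).rev) h1 h2 (fun i hi' =>
      hc.ancestorOfColour_congr hi hl (by rwa [Fin.le_rev_iff])) _ le_rfl
    have h4 : ancestorOfColour G c b (c w).rev.rev = ancestorOfColour G c a (c w).rev.rev := h3
    rw [hc.ancestorOfColour_eq_some.2 ⟨hi, by simp⟩] at h4
    exact (hc.ancestorOfColour_eq_some.1 h4).1
  -- Ancestors have distinct colours, so bags have at most `vr G` elements, one fewer than required.
  · intro i
    obtain ⟨v, hv⟩ := hBkey i
    have hinj : Set.InjOn c (B i) := fun x hx y hy h =>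
      hc.eq_of_isAncestor ((hB i v hv x).1 hx) ((hB i v hv y).1 hy) h
    have := Finset.card_le_card_of_injOn c (fun _ _ => Finset.mem_univ _) hinj
    rw [Finset.card_univ, Fintype.card_fin] at this
    omega

end Key

/-! ### Vertex expansion against tree-width -/

section Expansion

variable {V : Type*} [Fintype V] {G : SimpleGraph V}

lemma vertexExpansion_le {X : Finset V} (hX : X.Nonempty) (h : 2 * X.card ≤ Fintype.card V) :
    vertexExpansion G ≤ ((outerBoundary G X).ncard : ℝ) / (X.card : ℝ) := by
  refine csInf_le ⟨0, ?_⟩ ⟨X, hX, h, rfl⟩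
  rintro r ⟨Y, -, -, rfl⟩
  positivity

lemma vertexExpansion_mul_le {X : Finset V} (h : 2 * X.card ≤ Fintype.card V) :
    vertexExpansion G * X.card ≤ (outerBoundary G X).ncard := by
  rcases X.eq_empty_or_nonempty with rfl | hX
  · simp
  · have hpos : (0 : ℝ) < X.card := by exact_mod_cast hX.card_pos
    exact (le_div_iff₀ hpos).1 (vertexExpansion_le hX h)

lemma le_vertexExpansion (hV : 2 ≤ Fintype.card V) {r : ℝ}
    (h : ∀ X : Finset V, 2 * X.card ≤ Fintype.card V → r * X.card ≤ (outerBoundary G X).ncard) :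
    r ≤ vertexExpansion G := by
  refine le_csInf ?_ ?_
  -- A singleton is admissible, so the infimum is not the default 0 of the empty set.
  · have : Nonempty V := Fintype.card_pos_iff.1 (by omega)
    exact ⟨_, {Classical.arbitrary V}, Finset.singleton_nonempty _, by simpa using hV, rfl⟩
  · rintro _ ⟨X, hX, hc, rfl⟩
    have hpos : (0 : ℝ) < X.card := by exact_mod_cast hX.card_pos
    exact (le_div_iff₀ hpos).2 (h X hc)

/-- The closed neighbourhood of n/8 vertices Y covers at most n/2. A set X of n/2 vertices outside
it has boundary disjoint from Y, so of size about 3n/8. The ratio 3/4 becomes 4/5 to cover rounding.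
-/
lemma IsCubic.vertexExpansion_le (hG : IsCubic G) (hV : 76 ≤ Fintype.card V) :
    vertexExpansion G ≤ 4 / 5 := by
  classical
  obtain ⟨Y, -, hY⟩ := Finset.exists_subset_card_eq
    (s := (Finset.univ : Finset V)) (n := Fintype.card V / 8)
    (by rw [Finset.card_univ]; omega)
  set N := Y.biUnion fun v => insert v (G.neighborFinset v) with hN
  have hNcard : N.card ≤ Y.card * 4 := by
    refine Finset.card_biUnion_le_card_mul _ _ _ fun v _ => ?_
    refine (Finset.card_insert_le _ _).trans ?_
    rw [SimpleGraph.card_neighborFinset_eq_degree]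
    have h3 := hG v
    have : G.degree v = 3 := by convert h3
    omega
  have hcomp := Finset.card_compl_add_card N
  obtain ⟨X, hXN, hX⟩ := Finset.exists_subset_card_eq (s := Nᶜ) (n := Fintype.card V / 2)
    (by omega)
  have hsub : outerBoundary G X ⊆ ((X ∪ Y)ᶜ : Finset V) := by
    rintro v ⟨hv, u, hu, huv⟩
    simp only [Finset.coe_compl, Finset.coe_union, Set.mem_compl_iff, Set.mem_union,
      Finset.mem_coe, not_or]
    refine ⟨hv, fun hvY => ?_⟩
    have := hXN hu
    rw [Finset.mem_compl] at this
    exact this (Finset.mem_biUnion.2 ⟨v, hvY, Finset.mem_insert_of_mem (by simpa using huv.symm)⟩)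
  have hdisj : Disjoint X Y := Finset.disjoint_left.2 fun v hv hvY =>
    Finset.mem_compl.1 (hXN hv) (Finset.mem_biUnion.2 ⟨v, hvY, Finset.mem_insert_self _ _⟩)
  have h1 := Set.ncard_le_ncard hsub (Finset.finite_toSet _)
  rw [Set.ncard_coe_finset] at h1
  have h2 := Finset.card_compl_add_card (X ∪ Y)
  rw [Finset.card_union_of_disjoint hdisj] at h2
  have hXne : X.Nonempty := Finset.card_pos.1 (by omega)
  refine (VRank.vertexExpansion_le hXne (by omega)).trans ?_
  have hpos : (0 : ℝ) < X.card := by exact_mod_cast hXne.card_pos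
  rw [div_le_iff₀ hpos]
  have h3 : 5 * (outerBoundary G X).ncard ≤ 4 * X.card := by omega
  have h4 : (5 : ℝ) * (outerBoundary G X).ncard ≤ 4 * X.card := by exact_mod_cast h3
  linarith

/-- Tree-width is bounded below by the vertex expansion, up to an additive constant. -/
theorem vertexExpansion_mul_card_le [Nonempty V] (G : SimpleGraph V) (h0 : 0 ≤ vertexExpansion G) :
    vertexExpansion G * Fintype.card V ≤ (3 + vertexExpansion G) * (treewidth G + 1) := by
  classical
  obtain ⟨m, T, B, hD, hB⟩ := treewidth_spec G
  obtain ⟨t, f, hf, hbal⟩ := hD.exists_balanced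
  obtain ⟨X, hX1, hX2, hX3⟩ := exists_outerBoundary_subset (B t) f hf hbal
  have h1 := Set.ncard_le_ncard hX3 (Finset.finite_toSet _)
  rw [Set.ncard_coe_finset] at h1
  have h2 := vertexExpansion_mul_le (G := G) hX2
  have h3 : ((outerBoundary G X).ncard : ℝ) ≤ (B t).card := by exact_mod_cast h1
  have h4 : ((B t).card : ℝ) ≤ treewidth G + 1 := by exact_mod_cast hB t
  have h5 : (Fintype.card V : ℝ) ≤ 3 * X.card + (B t).card := by exact_mod_cast hX1
  have h6 := mul_le_mul_of_nonneg_left h5 h0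
  have h7 := mul_le_mul_of_nonneg_left h4 h0
  linarith

/-- With h ≤ 4/5 one has tw ≥ h·n/3.8 − 1, and this is at least h·n/4 when h·n ≥ 76. -/
theorem vertexExpansion_mul_div_four_le (hG : IsCubic G) (hV : 76 * 144 ≤ Fintype.card V)
    (h : 1 / 144 ≤ vertexExpansion G) :
    vertexExpansion G * Fintype.card V / 4 ≤ treewidth G := by
  have : Nonempty V := Fintype.card_pos_iff.1 (by omega)
  have h1 := vertexExpansion_mul_card_le G (by linarith)
  have h2 := hG.vertexExpansion_le (by omega)
  have h3 : ((76 * 144 : ℕ) : ℝ) ≤ Fintype.card V := by exact_mod_cast hV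
  push_cast at h3
  have h4 : (76 : ℝ) ≤ vertexExpansion G * Fintype.card V := by nlinarith
  have h5 : (0 : ℝ) ≤ treewidth G := by positivity
  nlinarith

end Expansion

lemma isCubic_of_forall_adj_iff {V : Type*} [Fintype V] {G : SimpleGraph V}
    (h : ∀ v, ∃ a b c, a ≠ b ∧ a ≠ c ∧ b ≠ c ∧ ∀ w, G.Adj v w ↔ w = a ∨ w = b ∨ w = c) :
    IsCubic G := by
  classical
  intro v
  obtain ⟨a, b, c, hab, hac, hbc, hv⟩ := h v
  rw [← SimpleGraph.card_neighborFinset_eq_degree, Finset.card_eq_three]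
  exact ⟨a, b, c, hab, hac, hbc, by ext w; simp [hv]⟩

/-! ### Cubic graphs from expanding permutations -/

section Replacement

variable {W : Type*}

/-- The permutation attached to each of the `48` ports: the `24` given ones on the first half of the
ports, their inverses on the second half. -/
def portPerm (π : Fin 24 → Equiv.Perm W) (j : ZMod 48) : Equiv.Perm W :=
  if h : j.val < 24 then π ⟨j.val, h⟩ else (π ⟨j.val - 24, by have := j.val_lt; omega⟩)⁻¹

lemma val_add_half (j : ZMod 48) :
    (j + 24).val = if j.val < 24 then j.val + 24 else j.val - 24 := by
  revert j
  decide

lemma portPerm_add_half (π : Fin 24 → Equiv.Perm W) (j : ZMod 48) :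
    portPerm π (j + 24) = (portPerm π j)⁻¹ := by
  have hj := j.val_lt
  unfold portPerm
  by_cases h : j.val < 24
  · have hv : (j + 24).val = j.val + 24 := by rw [val_add_half, if_pos h]
    rw [dif_neg (by omega), dif_pos h]
    simp [hv]
  · have hv : (j + 24).val = j.val - 24 := by rw [val_add_half, if_neg h]
    rw [dif_pos (by omega), dif_neg h]
    simp [hv]

/-- The replacement product with a cycle of the `48`-regular graph given by `24` permutations:
every vertex becomes a cycle of ports, and port `j` of `v` is matched with port `j + 24` of its
image. -/
def replacementGraph (π : Fin 24 → Equiv.Perm W) : SimpleGraph (W × ZMod 48) where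
  Adj x y := (x.1 = y.1 ∧ (y.2 = x.2 + 1 ∨ x.2 = y.2 + 1)) ∨
    (y.2 = x.2 + 24 ∧ y.1 = portPerm π x.2 x.1)
  symm := ⟨by
    rintro ⟨v, j⟩ ⟨w, l⟩ (⟨rfl, h⟩ | ⟨rfl, rfl⟩)
    · exact .inl ⟨rfl, h.symm⟩
    · refine .inr ⟨?_, ?_⟩
      · have : (24 : ZMod 48) + 24 = 0 := by decide
        simp [add_assoc, this]
      · simp [portPerm_add_half]⟩
  loopless := ⟨by
    rintro ⟨v, j⟩ (⟨-, h⟩ | ⟨h, -⟩)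
    · have : (1 : ZMod 48) ≠ 0 := by decide
      simp [this] at h
    · have : (24 : ZMod 48) ≠ 0 := by decide
      simp [this] at h⟩

lemma replacementGraph_adj_iff (π : Fin 24 → Equiv.Perm W) (v : W) (j : ZMod 48)
    (y : W × ZMod 48) : (replacementGraph π).Adj (v, j) y ↔
      y = (v, j + 1) ∨ y = (v, j - 1) ∨ y = (portPerm π j v, j + 24) := by
  obtain ⟨w, l⟩ := y
  simp only [replacementGraph, Prod.mk.injEq, eq_sub_iff_add_eq]
  constructor
  · rintro (⟨rfl, rfl | rfl⟩ | ⟨rfl, rfl⟩) <;> simp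
  · rintro (⟨rfl, rfl⟩ | ⟨rfl, rfl⟩ | ⟨rfl, rfl⟩) <;> simp

variable [Fintype W] [DecidableEq W]

/-- Every set of at most half of the points is expanded by the permutations by a factor `3 / 2`. -/
def IsExpandingFamily (π : Fin 24 → Equiv.Perm W) : Prop :=
  ∀ A : Finset W, 2 * A.card ≤ Fintype.card W →
    3 * A.card ≤ 2 * (Finset.univ.biUnion fun i => A.image (π i)).card

/-- Sort the cycles into full (F), partial (P) and empty. Each partial cycle contains a boundary
point, as does each empty one hit by an image of F. So |∂X| is at least |P| and at least |F|/2,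
while |X| ≤ 48(|F| + |P|). -/
lemma IsExpandingFamily.card_le {π : Fin 24 → Equiv.Perm W} (hπ : IsExpandingFamily π)
    (X : Finset (W × ZMod 48)) (hX : X.card ≤ 24 * Fintype.card W) :
    X.card ≤ 144 * (outerBoundary (replacementGraph π) X).ncard := by
  classical
  set F : Finset W := Finset.univ.filter fun v => ∀ j, (v, j) ∈ X with hF
  set P : Finset W := Finset.univ.filter fun v => (∃ j, (v, j) ∈ X) ∧ ∃ j, (v, j) ∉ X with hP
  set M : Finset W := Finset.univ.biUnion fun i => F.image (π i) with hM
  have hK : ∀ S : Finset W, (S ×ˢ (Finset.univ : Finset (ZMod 48))).card = S.card * 48 := by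
    intro S
    rw [Finset.card_product, Finset.card_univ, ZMod.card]
  have h1 : F.card * 48 ≤ X.card := by
    rw [← hK]
    refine Finset.card_le_card fun x hx => ?_
    simp only [hF, Finset.mem_product, Finset.mem_filter, Finset.mem_univ, true_and,
      and_true] at hx
    exact hx x.2
  have h2 : X.card ≤ (F.card + P.card) * 48 := by
    refine le_trans ?_ (Nat.mul_le_mul_right 48 (Finset.card_union_le F P))
    rw [← hK]
    refine Finset.card_le_card fun x hx => ?_
    simp only [hF, hP, Finset.mem_product, Finset.mem_union, Finset.mem_filter, Finset.mem_univ,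
      true_and, and_true]
    by_cases h : ∀ j, (x.1, j) ∈ X
    · exact .inl h
    · exact .inr ⟨⟨x.2, hx⟩, not_forall.1 h⟩
  have h3 : 3 * F.card ≤ 2 * M.card := hπ F (by omega)
  have hsub : ((P ∪ (M \ F) : Finset W) : Set W) ⊆
      Prod.fst '' outerBoundary (replacementGraph π) X := by
    intro v hv
    by_cases hvP : v ∈ P
    · obtain ⟨⟨a, ha⟩, b, hb⟩ := (Finset.mem_filter.1 hvP).2
      -- Going round a partial cycle, X must be left somewhere.
      obtain ⟨j, hj, hj'⟩ : ∃ j, (v, j) ∈ X ∧ (v, j + 1) ∉ X := by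
        by_contra! hno
        have hall : ∀ n : ℕ, (v, a + n) ∈ X := by
          intro n
          induction n with
          | zero => simpa using ha
          | succ n ih => simpa [add_assoc] using hno _ ih
        have := hall (b - a).val
        rw [ZMod.natCast_zmod_val] at this
        exact hb (by simpa using this)
      refine ⟨(v, j + 1), ⟨hj', (v, j), hj, ?_⟩, rfl⟩
      exact (replacementGraph_adj_iff π v j _).2 (.inl rfl)
    · have hvM : v ∈ M \ F := by
        rcases Finset.mem_union.1 hv with h | h
        · exact absurd h hvP
        · exact h
      obtain ⟨hvM, hvF⟩ := Finset.mem_sdiff.1 hvM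
      obtain ⟨i, -, hi⟩ := Finset.mem_biUnion.1 hvM
      obtain ⟨u, hu, rfl⟩ := Finset.mem_image.1 hi
      have hempty : ∀ j, (π i u, j) ∉ X := by
        intro j hj
        simp only [hF, Finset.mem_filter, Finset.mem_univ, true_and, not_forall] at hvF
        exact hvP (by simpa [hP] using ⟨⟨j, hj⟩, hvF⟩)
      have hval : ((i.val : ℕ) : ZMod 48).val = i.val := ZMod.val_natCast_of_lt (by omega)
      refine ⟨(π i u, (i.val : ZMod 48) + 24), ⟨hempty _, (u, (i.val : ZMod 48)),
        (Finset.mem_filter.1 hu).2 _, ?_⟩, rfl⟩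
      refine (replacementGraph_adj_iff π u _ _).2 (.inr (.inr ?_))
      rw [portPerm, dif_pos (by rw [hval]; exact i.2)]
      simp [hval]
  have h4 := (Set.ncard_le_ncard hsub (Set.toFinite _)).trans (Set.ncard_image_le (Set.toFinite _))
  rw [Set.ncard_coe_finset] at h4
  have h5 : P.card ≤ (P ∪ (M \ F)).card := Finset.card_le_card Finset.subset_union_left
  have h6 : (M \ F).card ≤ (P ∪ (M \ F)).card := Finset.card_le_card Finset.subset_union_right
  have h7 := Finset.le_card_sdiff F M
  omega

/-- A family of expanding permutations gives a cubic graph with vertex expansion at least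
`1 / 144`. -/
theorem IsExpandingFamily.exists_cubic [Nonempty W] {π : Fin 24 → Equiv.Perm W}
    (hπ : IsExpandingFamily π) :
    ∃ G : SimpleGraph (Fin (48 * Fintype.card W)), IsCubic G ∧ 1 / 144 ≤ vertexExpansion G := by
  classical
  have hcard : Fintype.card (W × ZMod 48) = 48 * Fintype.card W := by
    rw [Fintype.card_prod, ZMod.card, mul_comm]
  let e : Fin (48 * Fintype.card W) ≃ W × ZMod 48 := (Fintype.equivFinOfCardEq hcard).symm
  refine ⟨(replacementGraph π).comap e, isCubic_of_forall_adj_iff fun x => ?_,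
    le_vertexExpansion ?_ fun X hX => ?_⟩
  · have d1 : ∀ j : ZMod 48, j + 1 ≠ j - 1 := by decide
    have d2 : ∀ j : ZMod 48, j + 1 ≠ j + 24 := by decide
    have d3 : ∀ j : ZMod 48, j - 1 ≠ j + 24 := by decide
    refine ⟨e.symm ((e x).1, (e x).2 + 1), e.symm ((e x).1, (e x).2 - 1),
      e.symm (portPerm π (e x).2 (e x).1, (e x).2 + 24), ?_, ?_, ?_, fun y => ?_⟩
    · exact fun h => d1 _ (congrArg Prod.snd (e.symm.injective h))
    · exact fun h => d2 _ (congrArg Prod.snd (e.symm.injective h))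
    · exact fun h => d3 _ (congrArg Prod.snd (e.symm.injective h))
    · rw [SimpleGraph.comap_adj]
      refine (replacementGraph_adj_iff π (e x).1 (e x).2 (e y)).trans ?_
      simp only [Equiv.eq_symm_apply]
  · have := Fintype.card_pos (α := W)
    rw [Fintype.card_fin]
    omega
  · rw [Fintype.card_fin] at hX
    have h1 := hπ.card_le (X.map e.toEmbedding) (by rw [Finset.card_map]; omega)
    have h2 : outerBoundary (replacementGraph π) (X.map e.toEmbedding) ⊆
        e '' outerBoundary ((replacementGraph π).comap e) X := by
      rintro y ⟨hy, u, hu, huy⟩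
      obtain ⟨x, hx, rfl⟩ := Finset.mem_map.1 hu
      obtain ⟨z, rfl⟩ := e.surjective y
      refine ⟨z, ⟨fun hz => hy (Finset.mem_map_of_mem _ hz), x, hx, huy⟩, rfl⟩
    have h3 := (Set.ncard_le_ncard h2 (Set.toFinite _)).trans (Set.ncard_image_le (Set.toFinite _))
    rw [Finset.card_map] at h1
    have h4 : (X.card : ℝ) ≤ 144 * (outerBoundary ((replacementGraph π).comap e) X).ncard := by
      exact_mod_cast h1.trans (Nat.mul_le_mul_left _ h3)
    linarith

end Replacement

/-! ### Counting permutations that map A into B -/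

section Counting

variable {W : Type*} [Fintype W] [DecidableEq W]

/-- The permutations mapping `A` into `B`. -/
def permsInto (A B : Finset W) : Finset (Equiv.Perm W) :=
  Finset.univ.filter fun π => ∀ x ∈ A, π x ∈ B

/-- Compose with a permutation of W extending a bijection from A to A'. -/
lemma card_permsInto_congr {A A' : Finset W} (h : A.card = A'.card) (B : Finset W) :
    (permsInto A B).card = (permsInto A' B).card := by
  let e : {x // x ∈ A} ≃ {x // x ∈ A'} := Finset.equivOfCardEq h
  let σ : Equiv.Perm W := e.extendSubtype
  have hσ : ∀ x, σ x ∈ A' ↔ x ∈ A := fun x =>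
    ⟨fun hx => by_contra fun hn => e.extendSubtype_not_mem x hn hx, e.extendSubtype_mem x⟩
  refine Finset.card_bij' (fun π _ => π * σ⁻¹) (fun π _ => π * σ) ?_ ?_ ?_ ?_
  · intro π hπ
    simp only [permsInto, Finset.mem_filter, Finset.mem_univ, true_and] at hπ ⊢
    exact fun x hx => hπ _ ((hσ _).1 (by simpa using hx))
  · intro π hπ
    simp only [permsInto, Finset.mem_filter, Finset.mem_univ, true_and] at hπ ⊢
    exact fun x hx => hπ _ ((hσ x).2 hx)
  · simp
  · simp

/-- Double counting of pairs (A', π) with |A'| = |A| and π(A') ⊆ B: for fixed π, the sets A' are the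
|A|-subsets of the preimage of B. -/
lemma choose_mul_card_permsInto (A B : Finset W) :
    (Fintype.card W).choose A.card * (permsInto A B).card =
      (Fintype.card W).factorial * B.card.choose A.card := by
  have h1 : ∑ A' ∈ Finset.powersetCard A.card (Finset.univ : Finset W), (permsInto A' B).card =
      (Fintype.card W).choose A.card * (permsInto A B).card := by
    rw [Finset.sum_congr rfl fun A' hA' =>
      card_permsInto_congr (Finset.mem_powersetCard.1 hA').2 B]
    simp
  have h2 := Finset.sum_card_bipartiteAbove_eq_sum_card_bipartiteBelow
    (s := Finset.powersetCard A.card (Finset.univ : Finset W))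
    (t := (Finset.univ : Finset (Equiv.Perm W))) (fun A' π => ∀ x ∈ A', π x ∈ B)
  rw [← h1]
  refine h2.trans ?_
  rw [← Fintype.card_perm, ← Finset.card_univ, ← smul_eq_mul]
  refine Finset.sum_eq_card_nsmul fun π _ => ?_
  have : Finset.bipartiteBelow (fun (A' : Finset W) (π : Equiv.Perm W) => ∀ x ∈ A', π x ∈ B)
      (Finset.powersetCard A.card (Finset.univ : Finset W)) π =
      Finset.powersetCard A.card (B.map π.symm.toEmbedding) := by
    ext A'
    rw [Finset.bipartiteBelow, Finset.mem_filter, Finset.mem_powersetCard_univ,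
      Finset.mem_powersetCard, and_comm, Finset.subset_iff]
    simp only [Finset.mem_map_equiv, Equiv.symm_symm]
  rw [this, Finset.card_powersetCard, Finset.card_map]

end Counting

/-! ### Numerical estimates for the union bound -/

section Estimates

lemma descFactorial_mul_pow_le {b N : ℕ} (h : b ≤ N) (a : ℕ) :
    b.descFactorial a * N ^ a ≤ N.descFactorial a * b ^ a := by
  induction a with
  | zero => simp
  | succ a ih =>
    rw [Nat.descFactorial_succ, Nat.descFactorial_succ, pow_succ, pow_succ]
    have h1 : (b - a) * N ≤ (N - a) * b := by
      rw [Nat.sub_mul, Nat.sub_mul, mul_comm b N]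
      exact Nat.sub_le_sub_left (Nat.mul_le_mul_left a h) _
    calc (b - a) * b.descFactorial a * (N ^ a * N)
        = ((b - a) * N) * (b.descFactorial a * N ^ a) := by ring
      _ ≤ ((N - a) * b) * (N.descFactorial a * b ^ a) := Nat.mul_le_mul h1 ih
      _ = _ := by ring

lemma choose_div_choose_le {a b N : ℕ} (hb : b ≤ N) (ha : a ≤ N) (hN : 0 < N) :
    (b.choose a : ℝ) / N.choose a ≤ ((b : ℝ) / N) ^ a := by
  have h := descFactorial_mul_pow_le hb a
  rw [Nat.descFactorial_eq_factorial_mul_choose, Nat.descFactorial_eq_factorial_mul_choose,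
    mul_assoc, mul_assoc] at h
  have h' := Nat.le_of_mul_le_mul_left h (Nat.factorial_pos a)
  have hc : (0 : ℝ) < N.choose a := by exact_mod_cast Nat.choose_pos ha
  have hN' : (0 : ℝ) < (N : ℝ) ^ a := by positivity
  rw [div_pow, div_le_div_iff₀ hc hN', mul_comm ((b : ℝ) ^ a)]
  exact_mod_cast h'

/-- From m^m/m! ≤ e^m ≤ 3^m. Using a ≤ m in the denominator gives both binomials of the union bound
the same base. -/
lemma choose_le_three_mul_pow {a m : ℕ} (N : ℕ) (ha : 0 < a) (hm : a ≤ m) :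
    (N.choose m : ℝ) ≤ (3 * (N / a)) ^ m := by
  have hm' : (0 : ℝ) < m := by exact_mod_cast ha.trans_le hm
  have ha' : (0 : ℝ) < a := by exact_mod_cast ha
  have h1 : (m : ℝ) ^ m / m.factorial ≤ 3 ^ m := by
    refine (Real.pow_div_factorial_le_exp _ hm'.le m).trans ?_
    rw [← Real.exp_one_pow]
    exact pow_le_pow_left₀ (Real.exp_pos 1).le (Real.exp_one_lt_d9.le.trans (by norm_num)) m
  calc (N.choose m : ℝ) ≤ (N : ℝ) ^ m / m.factorial := Nat.choose_le_pow_div m N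
    _ = ((m : ℝ) ^ m / m.factorial) * (N / m) ^ m := by
        rw [div_pow]
        field_simp
    _ ≤ 3 ^ m * (N / a) ^ m := by gcongr
    _ = _ := by rw [mul_pow]

/-- With x = N/a ≥ 2 the factors are at most (3x)^a, (3x)^(2a) and (3/(2x))^(24a). The base
27·(3/2)^24·x^(−21) is largest at x = 2, where it is below 1/4. -/
lemma union_bound_term {a N : ℕ} (ha : 0 < a) (haN : 2 * a ≤ N) :
    (N.choose a : ℝ) * N.choose (3 * a / 2) * (((3 * a / 2).choose a : ℝ) / N.choose a) ^ 24 ≤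
      (1 / 4) ^ a := by
  set b := 3 * a / 2 with hb
  have ha' : (0 : ℝ) < a := by exact_mod_cast ha
  have hN' : (0 : ℝ) < N := by exact_mod_cast (by omega : 0 < N)
  set x : ℝ := N / a with hx
  have hx2 : 2 ≤ x := by
    rw [hx, le_div_iff₀ ha']
    exact_mod_cast haN
  have h1 : (N.choose a : ℝ) ≤ (3 * x) ^ a := choose_le_three_mul_pow N ha le_rfl
  have h2 : (N.choose b : ℝ) ≤ (3 * x) ^ (2 * a) :=
    (choose_le_three_mul_pow N ha (by omega)).trans
      (pow_le_pow_right₀ (by linarith) (by omega))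
  have h3 : ((b.choose a : ℝ) / N.choose a) ≤ (3 / 2 * x⁻¹) ^ a := by
    refine (choose_div_choose_le (by omega) (by omega) (by omega)).trans ?_
    refine pow_le_pow_left₀ (by positivity) ?_ a
    have hb2 : (b : ℝ) ≤ 3 / 2 * a := by
      have : 2 * b ≤ 3 * a := by omega
      have : (2 : ℝ) * b ≤ 3 * a := by exact_mod_cast this
      linarith
    rw [hx, inv_div, div_le_iff₀ hN']
    field_simp
    linarith
  have hinv : x⁻¹ ≤ 1 / 2 := by
    rw [inv_le_comm₀ (by linarith) (by norm_num)]
    norm_num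
    exact hx2
  have hx0 : 0 < x := by linarith
  calc (N.choose a : ℝ) * N.choose b * ((b.choose a : ℝ) / N.choose a) ^ 24
      ≤ (3 * x) ^ a * (3 * x) ^ (2 * a) * ((3 / 2 * x⁻¹) ^ a) ^ 24 := by gcongr
    _ = ((3 * x) * (3 * x) ^ 2 * (3 / 2 * x⁻¹) ^ 24) ^ a := by
        rw [mul_pow (3 * x * (3 * x) ^ 2), mul_pow (3 * x), ← pow_mul, ← pow_mul, ← pow_mul,
          mul_comm 24 a]
    _ = (27 * (3 / 2) ^ 24 * x⁻¹ ^ 21) ^ a := by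
        congr 1
        field_simp
        norm_num
    _ ≤ (27 * (3 / 2) ^ 24 * (1 / 2) ^ 21) ^ a := by gcongr
    _ ≤ (1 / 4) ^ a := by
        refine pow_le_pow_left₀ (by norm_num) (by norm_num) a

lemma sum_quarter_pow_lt_one (n : ℕ) : ∑ a ∈ Finset.Icc 1 n, (1 / 4 : ℝ) ^ a < 1 := by
  have : ∑ a ∈ Finset.Icc 1 n, (1 / 4 : ℝ) ^ a = (1 - (1 / 4) ^ n) / 3 := by
    induction n with
    | zero => simp
    | succ n ih =>
      rw [Finset.sum_Icc_succ_top (by omega), ih]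
      ring
  rw [this]
  have : (0 : ℝ) < (1 / 4) ^ n := by positivity
  linarith

end Estimates

/-! ### Existence of expanding permutations and cubic expanders -/

theorem exists_isExpandingFamily (W : Type*) [Fintype W] [DecidableEq W] :
    ∃ π : Fin 24 → Equiv.Perm W, IsExpandingFamily π := by
  set N := Fintype.card W with hN
  by_contra! hcon
  let bad : Finset (Fin 24 → Equiv.Perm W) := (Finset.Icc 1 (N / 2)).biUnion fun a =>
    (Finset.powersetCard a Finset.univ).biUnion fun A =>
      (Finset.powersetCard (3 * a / 2) Finset.univ).biUnion fun B =>
        Fintype.piFinset fun _ => permsInto A B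
  have hbad : bad = Finset.univ := by
    refine Finset.eq_univ_of_forall fun π => ?_
    have h := hcon π
    simp only [IsExpandingFamily, not_forall, not_le] at h
    obtain ⟨A, hA, hlt⟩ := h
    -- When A fails to expand, the union of its images can be enlarged to a set of exactly ⌊3|A|/2⌋
    -- points, so only one size of B is counted.
    obtain ⟨B, hB, -, hBc⟩ := Finset.exists_subsuperset_card_eq (n := 3 * A.card / 2)
      (Finset.subset_univ (Finset.univ.biUnion fun i => A.image (π i))) (by omega)
      (by rw [Finset.card_univ]; omega)
    simp only [bad, Finset.mem_biUnion, Finset.mem_Icc, Finset.mem_powersetCard_univ,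
      Fintype.mem_piFinset, permsInto, Finset.mem_filter, Finset.mem_univ, true_and]
    exact ⟨A.card, ⟨by omega, by omega⟩, A, rfl, B, hBc, fun i x hx => hB
      (Finset.mem_biUnion.2 ⟨i, Finset.mem_univ _, Finset.mem_image_of_mem _ hx⟩)⟩
  have hcard : (bad.card : ℝ) ≤ ∑ a ∈ Finset.Icc 1 (N / 2),
      (1 / 4 : ℝ) ^ a * (N.factorial : ℝ) ^ 24 := by
    refine (Nat.cast_le.2 Finset.card_biUnion_le).trans ?_
    rw [Nat.cast_sum]
    refine Finset.sum_le_sum fun a ha => ?_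
    rw [Finset.mem_Icc] at ha
    set r : ℝ := ((3 * a / 2).choose a : ℝ) / N.choose a with hr
    have hinner : ∀ A ∈ Finset.powersetCard a (Finset.univ : Finset W),
        ∀ B ∈ Finset.powersetCard (3 * a / 2) (Finset.univ : Finset W),
        ((Fintype.piFinset fun _ : Fin 24 => permsInto A B).card : ℝ) =
          (N.factorial * r) ^ 24 := by
      intro A hA B hB
      rw [Finset.mem_powersetCard_univ] at hA hB
      have h := choose_mul_card_permsInto A B
      rw [hA, hB, ← hN] at h
      have hc : (0 : ℝ) < N.choose a := by exact_mod_cast Nat.choose_pos (by omega)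
      have h' : (N.choose a : ℝ) * (permsInto A B).card =
        N.factorial * (3 * a / 2).choose a := by exact_mod_cast h
      rw [Fintype.card_piFinset_const, Nat.cast_pow, hr, ← mul_div_assoc, ← h',
        mul_div_cancel_left₀ _ hc.ne']
    have hterm := union_bound_term (a := a) (N := N) (by omega) (by omega)
    calc _ ≤ ∑ A ∈ Finset.powersetCard a (Finset.univ : Finset W),
          ∑ B ∈ Finset.powersetCard (3 * a / 2) (Finset.univ : Finset W),
            ((Fintype.piFinset fun _ : Fin 24 => permsInto A B).card : ℝ) := by
          refine (Nat.cast_le.2 Finset.card_biUnion_le).trans ?_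
          rw [Nat.cast_sum]
          refine Finset.sum_le_sum fun A _ => ?_
          refine (Nat.cast_le.2 Finset.card_biUnion_le).trans ?_
          rw [Nat.cast_sum]
      _ = (N.choose a : ℝ) * N.choose (3 * a / 2) * r ^ 24 * (N.factorial : ℝ) ^ 24 := by
          rw [Finset.sum_congr rfl fun A hA => Finset.sum_congr rfl (hinner A hA)]
          simp only [Finset.sum_const, Finset.card_powersetCard, Finset.card_univ, ← hN,
            nsmul_eq_mul]
          ring
      _ ≤ _ := by gcongr
  rw [hbad, Finset.card_univ, Fintype.card_fun, Fintype.card_perm, Fintype.card_fin, ← hN,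
    ← Finset.sum_mul, Nat.cast_pow] at hcard
  have := sum_quarter_pow_lt_one (N / 2)
  have hpos : (0 : ℝ) < (N.factorial : ℝ) ^ 24 := by positivity
  nlinarith

theorem exists_cubic_expander (N : ℕ) (hN : 0 < N) :
    ∃ G : SimpleGraph (Fin (48 * N)), IsCubic G ∧ 1 / 144 ≤ vertexExpansion G := by
  have : Nonempty (Fin N) := ⟨⟨0, hN⟩⟩
  obtain ⟨π, hπ⟩ := exists_isExpandingFamily (Fin N)
  have h := hπ.exists_cubic
  rwa [Fintype.card_fin] at h

end VRank

theorem mainTheorem9 :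
    ∃ F : Set (Σ n : ℕ, SimpleGraph (Fin n)),
      F.Infinite ∧
      (∀ G ∈ F, VRank.IsCubic G.2) ∧
      (∃ h : ℝ, 0 < h ∧ ∀ G ∈ F, h ≤ VRank.vertexExpansion G.2) ∧
      (∀ G ∈ F,
        VRank.pathwidth G.2 ≤ VRank.vr G.2 ∧
        VRank.treewidth G.2 ≤ VRank.pathwidth G.2 ∧
        VRank.vertexExpansion G.2 * (G.1 : ℝ) / 4 ≤ (VRank.treewidth G.2 : ℝ)) ∧
      (∃ c : ℝ, 0 < c ∧ ∀ G ∈ F, c * (G.1 : ℝ) ≤ (VRank.vr G.2 : ℝ)) := by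
  have hchain : ∀ G : Σ n : ℕ, SimpleGraph (Fin n), 76 * 144 ≤ G.1 → VRank.IsCubic G.2 →
      1 / 144 ≤ VRank.vertexExpansion G.2 →
      VRank.pathwidth G.2 ≤ VRank.vr G.2 ∧ VRank.treewidth G.2 ≤ VRank.pathwidth G.2 ∧
        VRank.vertexExpansion G.2 * (G.1 : ℝ) / 4 ≤ (VRank.treewidth G.2 : ℝ) := by
    rintro ⟨n, G⟩ hn hG hh
    simp only at hn
    have : Nonempty (Fin n) := ⟨⟨0, by omega⟩⟩
    refine ⟨VRank.pathwidth_le_vr G, VRank.treewidth_le_pathwidth G, ?_⟩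
    simpa using VRank.vertexExpansion_mul_div_four_le hG (by simpa using hn) hh
  -- The constant for `vr` is 1/576 = (1/144)/4.
  refine ⟨{G | 76 * 144 ≤ G.1 ∧ VRank.IsCubic G.2 ∧ 1 / 144 ≤ VRank.vertexExpansion G.2},
    ?_, fun G hG => hG.2.1, ⟨1 / 144, by norm_num, fun G hG => hG.2.2⟩,
    fun G hG => hchain G hG.1 hG.2.1 hG.2.2, ⟨1 / 576, by norm_num, fun G hG => ?_⟩⟩
  -- The shift makes the graphs large enough: 48 · 228 = 76 · 144.
  · choose G hG using fun N : ℕ => VRank.exists_cubic_expander (N + 228) (by omega)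
    refine Set.infinite_of_injective_forall_mem (f := fun N => ⟨48 * (N + 228), G N⟩) ?_
      fun N => ⟨?_, hG N⟩
    · intro M N h
      have := congrArg Sigma.fst h
      simp only at this
      omega
    · simp only
      omega
  · obtain ⟨h1, h2, h3⟩ := hchain G hG.1 hG.2.1 hG.2.2
    have h4 : (VRank.treewidth G.2 : ℝ) ≤ VRank.vr G.2 := by exact_mod_cast h2.trans h1
    have h5 := mul_le_mul_of_nonneg_right hG.2.2 (Nat.cast_nonneg (α := ℝ) G.1)
    linarith
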